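/- Let $V\in L^\infty(\mathbb R)$ be real-valued with $0<v_0\le V(x)\le v_1$ for a.e. $x\in\mathbb R$, where $v_0,v_1$ are constants, and let $a\in\mathbb R$. Elements of $H^1(\mathbb R)=W^{1,2}(\mathbb R)$ are real-valued and identified with their continuous representatives. For $u\in H^1(\mathbb R)$ put $$\|u\|_V^2=\int_{\mathbb R}\bigl(|u'(x)|^2+V(x)|u(x)|^2\bigr)\,dx ,$$ and let $$K_a=\{u\in H^1(\mathbb R):\ u(a)=\|u\|_{L^\infty(\mathbb R)}=1\},\qquad F(a)=\inf_{u\in K_a}\|u\|_V^2 .$$ Then there exists a unique minimizer $u_a\in K_a$ of $\|\cdot\|_V^2$ over $K_a$, so that $F(a)=\min_{u\in K_a}\|u\|_V^2=\|u_a\|_V^2$, and it has the following properties. 1. $u_a\in W^{2,\infty}(\mathbb R\setminus\{a\})$, and $u_a''(x)=V(x)u_a(x)$ for a.e. $x\in\mathbb R\setminus\{a\}$, where $u_a''$ is the second weak derivative on $\mathbb R\setminus\{a\}$. 2. For all $x\in\mathbb R$, $$e^{-\sqrt{v_1}\,|x-a|}\le u_a(x)\le e^{-\sqrt{v_0}\,|x-a|}.$$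 3. $u_a$ is continuously differentiable on $\mathbb R\setminus\{a\}$, and for all $x\in\mathbb R\setminus\{a\}$, $$\frac{v_0}{\sqrt{v_1}}\,e^{-\sqrt{v_1}\,|x-a|}\le \operatorname{sgn}(a-x)\,u_a'(x)\le \frac{v_1}{\sqrt{v_0}}\,e^{-\sqrt{v_0}\,|x-a|}.$$ In particular, if $V$ is (a.e. equal to) a positive constant $c$, then $u_a(x)=e^{-\sqrt{c}\,|x-a|}$ for all $x\in\mathbb R$. -/

import Mathlib

open MeasureTheory Set
open scoped ENNReal ContDiff

noncomputable section

/-- `g` is a weak derivative of `u` on the open set `Ω ⊆ ℝ`: both functions are locally integrable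
on `Ω`, and `∫ u φ' = - ∫ g φ` for every test function `φ ∈ C_c^∞(Ω)`. -/
structure HasWeakDeriv (Ω : Set ℝ) (u g : ℝ → ℝ) : Prop where
  locallyIntegrableOn : LocallyIntegrableOn u Ω volume
  locallyIntegrableOn_deriv : LocallyIntegrableOn g Ω volume
  integral_eq : ∀ φ : ℝ → ℝ, ContDiff ℝ ∞ φ → HasCompactSupport φ → tsupport φ ⊆ Ω →
    ∫ x, u x * deriv φ x = - ∫ x, g x * φ x

/-- The weak derivative is unique up to a null set. -/
theorem HasWeakDeriv.ae_unique {Ω : Set ℝ} (hΩ : IsOpen Ω) {u g h : ℝ → ℝ}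
    (hg : HasWeakDeriv Ω u g) (hh : HasWeakDeriv Ω u h) :
    ∀ᵐ x ∂(volume : Measure ℝ), x ∈ Ω → g x = h x := by
  have key := hΩ.ae_eq_zero_of_integral_contDiff_smul_eq_zero (μ := volume)
    (f := fun x => g x - h x)
    (hg.locallyIntegrableOn_deriv.sub hh.locallyIntegrableOn_deriv) (by
      intro φ hφ hc hs
      have hint : ∀ k : ℝ → ℝ, LocallyIntegrableOn k Ω volume →
          Integrable (fun x => φ x * k x) := by
        intro k hk
        have hK : IntegrableOn k (tsupport φ) :=
          hk.integrableOn_compact_subset hs hc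
        have h1 : IntegrableOn (fun x => φ x * k x) (tsupport φ) :=
          hK.continuousOn_mul hφ.continuous.continuousOn hc
        refine (integrableOn_iff_integrable_of_support_subset ?_).1 h1
        intro x hx
        refine subset_tsupport φ ?_
        intro h0
        exact hx (by simp [h0])
      have e1 := hg.integral_eq φ hφ hc hs
      have e2 := hh.integral_eq φ hφ hc hs
      have i1 := hint g hg.locallyIntegrableOn_deriv
      have i2 := hint h hh.locallyIntegrableOn_deriv
      have e3 : ∫ x, g x * φ x = ∫ x, h x * φ x := by linarith
      simp only [smul_eq_mul, mul_sub]
      rw [integral_sub i1 i2]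
      simp only [mul_comm (φ _)]
      rw [e3, sub_self])
  filter_upwards [key] with x hx hxΩ
  exact sub_eq_zero.1 (hx hxΩ)

open Classical in
/-- The weak derivative of `u` on `Ω` (a representative, determined up to a null set of `Ω`);
the value is `0` if `u` has no weak derivative on `Ω`. -/
def weakDeriv (Ω : Set ℝ) (u : ℝ → ℝ) : ℝ → ℝ :=
  if h : ∃ g, HasWeakDeriv Ω u g then h.choose else 0

theorem HasWeakDeriv.weakDeriv {Ω : Set ℝ} {u g : ℝ → ℝ} (h : HasWeakDeriv Ω u g) :
    HasWeakDeriv Ω u (weakDeriv Ω u) := by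
  have h' : ∃ g, HasWeakDeriv Ω u g := ⟨g, h⟩
  unfold _root_.weakDeriv
  rw [dif_pos h']
  exact h'.choose_spec

/-- `u ∈ W^{k,p}(Ω)`, for an open set `Ω ⊆ ℝ` and `1 ≤ p ≤ ∞`: the function `u` and its weak
derivatives up to order `k` exist and belong to `L^p(Ω)`. -/
def MemSobolev (p : ℝ≥0∞) (Ω : Set ℝ) : ℕ → (ℝ → ℝ) → Prop
  | 0, u => MemLp u p (volume.restrict Ω)
  | k + 1, u => MemLp u p (volume.restrict Ω) ∧
      ∃ g, HasWeakDeriv Ω u g ∧ MemSobolev p Ω k g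

/-- `H¹(ℝ) = W^{1,2}(ℝ)`, each class being represented by its continuous representative. -/
def H1 : Set (ℝ → ℝ) := {u | Continuous u ∧ MemSobolev 2 univ 1 u}

/-- `I(u; V) = ‖u‖_V² = ∫ (|u'|² + V |u|²) dx`. -/
def normVSq (V u : ℝ → ℝ) : ℝ :=
  ∫ x, ((weakDeriv univ u x) ^ 2 + V x * (u x) ^ 2)

/-- `K_a = {u ∈ H¹(ℝ) : u(a) = ‖u‖_{L^∞(ℝ)} = 1}`. -/
def KSet (a : ℝ) : Set (ℝ → ℝ) :=
  {u | u ∈ H1 ∧ u a = 1 ∧ eLpNorm u ∞ volume = 1}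

/-- `F(a) = inf_{u ∈ K_a} ‖u‖_V²`. -/
def FInf (V : ℝ → ℝ) (a : ℝ) : ℝ := sInf (normVSq V '' KSet a)

end

open scoped BoundedContinuousFunction

/-! The problem is solved by calibration. Let `p` be a solution on the whole line of the Riccati
equation `p' = p² - V` with `√v₀ ≤ p ≤ √v₁`. Then `(w' + p w)² = w'² + V w² + (p w²)'`, so
integration over `(a, ∞)` expresses the energy there as a nonnegative defect plus `p(a) w(a)²`. A
solution `r` with `-√v₁ ≤ r ≤ -√v₀` does the same on `(-∞, a]`. If `w(a) = 1`, the energy is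
therefore at least `p(a) - r(a)`, with equality exactly when `w' = -p w` on the right of `a` and `w'
= -r w` on the left. The initial value makes this `w` unique (`peak`), and it decays away from `a`,
so it meets the constraint on the sup norm. No compactness argument is needed.

The remaining properties are read off `p` and `r`: integrating their bounds gives the exponential
bounds on `u`, the identities `u' = -p u` and `u' = -r u` give those on `u'`, and the Riccati
equation turns into `u'' = V u`.

The existence of `p` (`exists_isPrimitive_riccati`) is a Banach fixed point; `r` comes from
reflection. As `V` is merely bounded, derivatives are handled through `IsPrimitive`, that is, local
absolute continuity. -/

/-! ### Primitives of locally integrable functions -/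

theorem locallyIntegrable_piecewise_Ioi {p q : ℝ → ℝ} (hp : LocallyIntegrable p volume)
    (hq : LocallyIntegrable q volume) (a : ℝ) [∀ x, Decidable (x ∈ Ioi a)] :
    LocallyIntegrable ((Ioi a).piecewise p q) volume := by
  intro x
  obtain ⟨s, hs, hi⟩ := hp x
  obtain ⟨t, ht, hj⟩ := hq x
  refine ⟨s ∩ t, Filter.inter_mem hs ht, ?_⟩
  exact Integrable.piecewise measurableSet_Ioi
    (Integrable.integrableOn (hi.mono_set inter_subset_left))
    (Integrable.integrableOn (hj.mono_set inter_subset_right))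

/-- `f` is a primitive of the locally integrable function `g` on the real line. -/
structure IsPrimitive (f g : ℝ → ℝ) : Prop where
  locallyIntegrable : LocallyIntegrable g volume
  integral_eq : ∀ x y, ∫ t in x..y, g t = f y - f x

namespace IsPrimitive

variable {f g h k : ℝ → ℝ}

theorem intervalIntegrable (hf : IsPrimitive f g) (x y : ℝ) :
    IntervalIntegrable g volume x y :=
  (hf.locallyIntegrable.integrableOn_isCompact isCompact_uIcc).intervalIntegrable

theorem eq_add_integral (hf : IsPrimitive f g) (x : ℝ) :
    f = fun y => f x + ∫ t in x..y, g t := by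
  ext y
  rw [hf.integral_eq]
  ring

theorem ae_hasDerivAt (hf : IsPrimitive f g) : ∀ᵐ x, HasDerivAt f (g x) x := by
  filter_upwards [LocallyIntegrable.ae_hasDerivAt_integral hf.locallyIntegrable] with x hx
  rw [hf.eq_add_integral 0]
  exact (hx 0).const_add _

theorem continuous (hf : IsPrimitive f g) : Continuous f := by
  rw [hf.eq_add_integral 0]
  exact continuous_const.add (intervalIntegral.continuous_primitive hf.intervalIntegrable 0)

theorem absolutelyContinuousOnInterval (hf : IsPrimitive f g) (x y : ℝ) :
    AbsolutelyContinuousOnInterval f x y := by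
  rw [hf.eq_add_integral x]
  exact (contDiffOn_const (n := 1)).absolutelyContinuousOnInterval.add
    ((hf.intervalIntegrable x y).absolutelyContinuousOnInterval_intervalIntegral (by simp))

/-- Both factors are absolutely continuous on every interval, which is all that integration by parts
requires. This is what allows `p w²` to be differentiated with no smoothness of `V`. -/
theorem mul (hf : IsPrimitive f g) (hh : IsPrimitive h k) :
    IsPrimitive (fun x => f x * h x) (fun x => g x * h x + f x * k x) where
  locallyIntegrable := by
    have h1 : LocallyIntegrable (fun x => g x * h x) := by
      simpa using hf.locallyIntegrable.smul_continuous hh.continuous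
    have h2 : LocallyIntegrable (fun x => f x * k x) := by
      simpa using hh.locallyIntegrable.continuous_smul hf.continuous
    exact h1.add h2
  integral_eq x y := by
    rw [← (hf.absolutelyContinuousOnInterval x y).integral_deriv_mul_eq_sub
      (hh.absolutelyContinuousOnInterval x y)]
    apply intervalIntegral.integral_congr_ae
    filter_upwards [hf.ae_hasDerivAt, hh.ae_hasDerivAt] with t h1 h2 _
    rw [h1.deriv, h2.deriv]

theorem congr_ae (hf : IsPrimitive f g) (hgk : g =ᵐ[volume] k) : IsPrimitive f k where
  locallyIntegrable := (locallyIntegrable_congr hgk).1 hf.locallyIntegrable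
  integral_eq x y := by
    rw [← hf.integral_eq]
    exact intervalIntegral.integral_congr_ae (by filter_upwards [hgk] with t ht _ using ht.symm)

theorem of_hasDerivAt (hd : ∀ x, HasDerivAt f (g x) x) (hg : Continuous g) :
    IsPrimitive f g where
  locallyIntegrable := hg.locallyIntegrable
  integral_eq _ _ := intervalIntegral.integral_eq_sub_of_hasDerivAt (fun x _ => hd x)
    (hg.intervalIntegrable _ _)

theorem of_integral_eq_from (hg : LocallyIntegrable g volume) (a : ℝ)
    (h : ∀ y, ∫ t in a..y, g t = f y - f a) : IsPrimitive f g where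
  locallyIntegrable := hg
  integral_eq x y := by
    have hi (x y : ℝ) : IntervalIntegrable g volume x y :=
      (hg.integrableOn_isCompact isCompact_uIcc).intervalIntegrable
    rw [← intervalIntegral.integral_interval_sub_left (hi a y) (hi a x), h, h]
    ring

theorem integral (hg : LocallyIntegrable g volume) (a : ℝ) :
    IsPrimitive (fun x => ∫ t in a..x, g t) g :=
  of_integral_eq_from hg a fun y => by simp

theorem neg (hf : IsPrimitive f g) : IsPrimitive (fun x => - f x) (fun x => - g x) where
  locallyIntegrable := hf.locallyIntegrable.neg
  integral_eq x y := by
    rw [intervalIntegral.integral_neg, hf.integral_eq]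
    ring

theorem comp_neg (hf : IsPrimitive f g) : IsPrimitive (fun x => f (-x)) (fun x => - g (-x)) where
  locallyIntegrable := by
    have h1 : LocallyIntegrable (fun x => g (-x)) := by
      intro x
      obtain ⟨s, hs, hi⟩ := hf.locallyIntegrable (-x)
      refine ⟨(fun x => -x) ⁻¹' s, continuous_neg.continuousAt hs, ?_⟩
      exact ((Measure.measurePreserving_neg (volume : Measure ℝ)).integrableOn_comp_preimage
        (MeasurableEquiv.neg ℝ).measurableEmbedding).2 hi
    exact h1.neg
  integral_eq x y := by
    rw [intervalIntegral.integral_neg, intervalIntegral.integral_comp_neg, hf.integral_eq]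
    ring

/-- Equal values at `a` mean that gluing creates no jump, so the derivative acquires no point mass
at `a`. -/
theorem piecewise (hf : IsPrimitive f g) (hh : IsPrimitive h k) {a : ℝ} (ha : f a = h a)
    [∀ x, Decidable (x ∈ Ioi a)] :
    IsPrimitive ((Ioi a).piecewise f h) ((Ioi a).piecewise g k) := by
  refine of_integral_eq_from (locallyIntegrable_piecewise_Ioi hf.locallyIntegrable
    hh.locallyIntegrable a) a fun y => ?_
  have e0 : (Ioi a).piecewise f h a = h a := piecewise_eq_of_notMem _ _ _ (by simp)
  rw [e0]
  rcases lt_or_ge a y with hy | hy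
  · rw [piecewise_eq_of_mem _ _ _ (mem_Ioi.2 hy), ← ha, ← hf.integral_eq]
    apply intervalIntegral.integral_congr_ae
    refine Filter.Eventually.of_forall fun t ht => ?_
    rw [uIoc_of_le hy.le] at ht
    exact piecewise_eq_of_mem _ _ _ (mem_Ioi.2 ht.1)
  · rw [piecewise_eq_of_notMem _ _ _ (by simpa using hy), ← hh.integral_eq]
    apply intervalIntegral.integral_congr_ae
    refine Filter.Eventually.of_forall fun t ht => ?_
    rw [uIoc_of_ge hy] at ht
    exact piecewise_eq_of_notMem _ _ _ (by simpa using ht.2)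

theorem integral_Ioi (hf : IsPrimitive f g) (a : ℝ) (hg : IntegrableOn g (Ioi a))
    (h0 : Filter.Tendsto f Filter.atTop (nhds 0)) : ∫ x in Ioi a, g x = - f a := by
  have h1 := intervalIntegral_tendsto_integral_Ioi a hg Filter.tendsto_id
  simp only [hf.integral_eq] at h1
  have h2 := h0.sub_const (f a)
  simpa using tendsto_nhds_unique h1 h2

theorem integral_Iic (hf : IsPrimitive f g) (a : ℝ) (hg : IntegrableOn g (Iic a))
    (h0 : Filter.Tendsto f Filter.atBot (nhds 0)) : ∫ x in Iic a, g x = f a := by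
  have h1 := intervalIntegral_tendsto_integral_Iic a hg Filter.tendsto_id
  simp only [hf.integral_eq] at h1
  have h2 := h0.const_sub (f a)
  simpa using tendsto_nhds_unique h1 h2

/-- A function that is integrable together with its derivative tends to zero at infinity. -/
theorem tendsto_zero (hf : IsPrimitive f g) (a : ℝ) (hg : IntegrableOn g (Ioi a))
    (hi : IntegrableOn f (Ioi a)) : Filter.Tendsto f Filter.atTop (nhds 0) := by
  have h1 := intervalIntegral_tendsto_integral_Ioi a hg Filter.tendsto_id
  simp only [hf.integral_eq] at h1
  have h2 := h1.add_const (f a)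
  simp only [id, sub_add_cancel] at h2
  have h3 : IntegrableAtFilter f Filter.atTop volume := ⟨Ioi a, Filter.Ioi_mem_atTop a, hi⟩
  -- The limit exists because the derivative is integrable. It must be `0`, since every
  -- neighbourhood of `+∞` has infinite measure.
  have h4 := h3.eq_zero_of_tendsto (fun s hs => by
    obtain ⟨b, hb⟩ := Filter.mem_atTop_sets.1 hs
    refine top_unique (le_trans ?_ (measure_mono (show Ici b ⊆ s from hb)))
    simp) h2
  rwa [h4] at h2

end IsPrimitive

/-! ### Primitives and weak derivatives -/

namespace IsPrimitive

variable {f g h k φ : ℝ → ℝ}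

theorem of_contDiff (hφ : ContDiff ℝ ∞ φ) : IsPrimitive φ (deriv φ) :=
  of_hasDerivAt (fun x => (hφ.differentiable (by simp) x).hasDerivAt)
    (hφ.continuous_deriv (by simp))

theorem integrable_mul_deriv (hf : IsPrimitive f g) (hφ : ContDiff ℝ ∞ φ)
    (hc : HasCompactSupport φ) : Integrable (fun x => f x * deriv φ x) :=
  (hf.continuous.mul (hφ.continuous_deriv (by simp))).integrable_of_hasCompactSupport
    hc.deriv.mul_left

theorem integrable_deriv_mul (hf : IsPrimitive f g) (hφ : ContDiff ℝ ∞ φ)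
    (hc : HasCompactSupport φ) : Integrable (fun x => g x * φ x) := by
  simpa [mul_comm] using
    hf.locallyIntegrable.integrable_smul_left_of_hasCompactSupport hφ.continuous hc

theorem integral_Ioi_mul_deriv (hf : IsPrimitive f g) (hφ : ContDiff ℝ ∞ φ)
    (hc : HasCompactSupport φ) (a : ℝ) :
    ∫ x in Ioi a, f x * deriv φ x = - (∫ x in Ioi a, g x * φ x) - f a * φ a := by
  have i1 := hf.integrable_mul_deriv hφ hc
  have i2 := hf.integrable_deriv_mul hφ hc
  have h0 : HasCompactSupport (fun x => f x * φ x) := hc.mul_left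
  have e := (hf.mul (of_contDiff hφ)).integral_Ioi a (i2.add i1).integrableOn
    (h0.is_zero_at_infty.mono_left _root_.atTop_le_cocompact)
  rw [integral_add i2.integrableOn i1.integrableOn] at e
  linarith

theorem integral_Iic_mul_deriv (hf : IsPrimitive f g) (hφ : ContDiff ℝ ∞ φ)
    (hc : HasCompactSupport φ) (a : ℝ) :
    ∫ x in Iic a, f x * deriv φ x = - (∫ x in Iic a, g x * φ x) + f a * φ a := by
  have i1 := hf.integrable_mul_deriv hφ hc
  have i2 := hf.integrable_deriv_mul hφ hc
  have h0 : HasCompactSupport (fun x => f x * φ x) := hc.mul_left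
  have e := (hf.mul (of_contDiff hφ)).integral_Iic a (i2.add i1).integrableOn
    (h0.is_zero_at_infty.mono_left _root_.atBot_le_cocompact)
  rw [integral_add i2.integrableOn i1.integrableOn] at e
  linarith

theorem hasWeakDeriv_univ (hf : IsPrimitive f g) : HasWeakDeriv univ f g where
  locallyIntegrableOn := hf.continuous.locallyIntegrable.locallyIntegrableOn _
  locallyIntegrableOn_deriv := hf.locallyIntegrable.locallyIntegrableOn _
  integral_eq φ hφ hc _ := by
    rw [← intervalIntegral.integral_Iic_add_Ioi (b := 0) (hf.integrable_mul_deriv hφ hc).integrableOn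
      (hf.integrable_mul_deriv hφ hc).integrableOn,
      ← intervalIntegral.integral_Iic_add_Ioi (b := 0) (hf.integrable_deriv_mul hφ hc).integrableOn
      (hf.integrable_deriv_mul hφ hc).integrableOn,
      hf.integral_Ioi_mul_deriv hφ hc, hf.integral_Iic_mul_deriv hφ hc]
    ring

-- Test functions supported off `a` vanish at `a`, so both boundary terms disappear and the two
-- pieces need not match there. This is needed for `u'`, which has different one-sided limits at
-- `a`.
open Classical in
theorem hasWeakDeriv_compl_singleton (hf : IsPrimitive f g) (hh : IsPrimitive h k) (a : ℝ) :
    HasWeakDeriv {a}ᶜ ((Ioi a).piecewise f h) ((Ioi a).piecewise g k) := by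
  refine ⟨(locallyIntegrable_piecewise_Ioi hf.continuous.locallyIntegrable
    hh.continuous.locallyIntegrable a).locallyIntegrableOn _,
    (locallyIntegrable_piecewise_Ioi hf.locallyIntegrable hh.locallyIntegrable a).locallyIntegrableOn _, ?_⟩
  intro φ hφ hc hs
  have h0 : φ a = 0 := by
    by_contra hne
    exact hs (subset_tsupport φ hne) rfl
  have split {p q : ℝ → ℝ} {ψ : ℝ → ℝ} (hp : Integrable (fun x => p x * ψ x))
      (hq : Integrable (fun x => q x * ψ x)) :
      ∫ x, (Ioi a).piecewise p q x * ψ x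
        = (∫ x in Iic a, q x * ψ x) + ∫ x in Ioi a, p x * ψ x := by
    have e1 : EqOn (fun x => (Ioi a).piecewise p q x * ψ x) (fun x => q x * ψ x) (Iic a) := by
      intro x hx
      simp only
      rw [piecewise_eq_of_notMem _ _ _ (by simpa using hx)]
    have e2 : EqOn (fun x => (Ioi a).piecewise p q x * ψ x) (fun x => p x * ψ x) (Ioi a) := by
      intro x hx
      simp only
      rw [piecewise_eq_of_mem _ _ _ hx]
    rw [← intervalIntegral.integral_Iic_add_Ioi (b := a)
      ((integrableOn_congr_fun e1 measurableSet_Iic).2 hq.integrableOn)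
      ((integrableOn_congr_fun e2 measurableSet_Ioi).2 hp.integrableOn),
      setIntegral_congr_fun measurableSet_Iic e1, setIntegral_congr_fun measurableSet_Ioi e2]
  rw [split (hf.integrable_mul_deriv hφ hc) (hh.integrable_mul_deriv hφ hc),
    split (hf.integrable_deriv_mul hφ hc) (hh.integrable_deriv_mul hφ hc),
    hf.integral_Ioi_mul_deriv hφ hc, hh.integral_Iic_mul_deriv hφ hc, h0]
  ring

end IsPrimitive

theorem HasWeakDeriv.congr_ae {Ω : Set ℝ} {u v g h : ℝ → ℝ} (hu : HasWeakDeriv Ω u g)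
    (huv : u =ᵐ[volume] v) (hgh : g =ᵐ[volume] h) : HasWeakDeriv Ω v h where
  locallyIntegrableOn := (locallyIntegrableOn_congr (ae_restrict_of_ae huv)).1
    hu.locallyIntegrableOn
  locallyIntegrableOn_deriv := (locallyIntegrableOn_congr (ae_restrict_of_ae hgh)).1
    hu.locallyIntegrableOn_deriv
  integral_eq φ hφ hc hs := by
    have e1 : ∫ x, v x * deriv φ x = ∫ x, u x * deriv φ x :=
      integral_congr_ae (by filter_upwards [huv] with x hx; rw [hx])
    have e2 : ∫ x, h x * φ x = ∫ x, g x * φ x :=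
      integral_congr_ae (by filter_upwards [hgh] with x hx; rw [hx])
    rw [e1, e2, hu.integral_eq φ hφ hc hs]

theorem HasWeakDeriv.mono {Ω Ω' : Set ℝ} {u g : ℝ → ℝ} (hu : HasWeakDeriv Ω u g) (h : Ω' ⊆ Ω) :
    HasWeakDeriv Ω' u g where
  locallyIntegrableOn := hu.locallyIntegrableOn.mono_set h
  locallyIntegrableOn_deriv := hu.locallyIntegrableOn_deriv.mono_set h
  integral_eq φ hφ hc hs := hu.integral_eq φ hφ hc (hs.trans h)

/-- A continuous function with vanishing weak derivative is constant. -/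
theorem eq_of_integral_mul_deriv_eq_zero {d : ℝ → ℝ} (hd : Continuous d)
    (h : ∀ φ : ℝ → ℝ, ContDiff ℝ ∞ φ → HasCompactSupport φ → ∫ x, d x * deriv φ x = 0)
    (x y : ℝ) : d x = d y := by
  let b : ℕ → ContDiffBump (0 : ℝ) := fun n =>
    ⟨1 / (n + 1 : ℝ) / 2, 1 / (n + 1 : ℝ), by positivity, half_lt_self (by positivity)⟩
  have hb : Filter.Tendsto (fun n => (b n).rOut) Filter.atTop (nhds 0) :=
    tendsto_one_div_add_atTop_nhds_zero_nat
  have lim (z : ℝ) := ContDiffBump.convolution_tendsto_right_of_continuous (μ := volume) hb hd z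
  -- Each mollification of `d` is constant: its derivative at `z` pairs `d` with `η'(z - t)`, which
  -- up to sign is the derivative of the test function `t ↦ η(z - t)`.
  have const (n : ℕ) : (convolution ((b n).normed volume) d (ContinuousLinearMap.lsmul ℝ ℝ) volume) x
      = (convolution ((b n).normed volume) d (ContinuousLinearMap.lsmul ℝ ℝ) volume) y := by
    set η := (b n).normed volume with hη
    have hs : ContDiff ℝ ∞ η := (b n).contDiff_normed
    have hc : HasCompactSupport η := (b n).hasCompactSupport_normed
    refine is_const_of_deriv_eq_zero (𝕜 := ℝ) ?_ ?_ x y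
    · intro z
      exact (hc.hasDerivAt_convolution_left (ContinuousLinearMap.lsmul ℝ ℝ)
        (hs.of_le (by simp)) hd.locallyIntegrable z).differentiableAt
    · intro z
      rw [(hc.hasDerivAt_convolution_left (ContinuousLinearMap.lsmul ℝ ℝ)
        (hs.of_le (by simp)) hd.locallyIntegrable z).deriv, convolution_eq_swap]
      have h1 := h (fun t => η (z - t)) (hs.comp (contDiff_const.sub contDiff_id))
        (hc.comp_homeomorph (Homeomorph.subLeft z))
      have h2 : ∀ t, deriv (fun t => η (z - t)) t = - deriv η (z - t) := fun t => by
        rw [deriv_comp_const_sub]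
      simp only [h2, mul_neg, integral_neg, neg_eq_zero] at h1
      rw [← h1]
      simp [mul_comm]
  refine tendsto_nhds_unique (lim x) ?_
  simp only [const]
  exact lim y

/-- The difference of `u` and the integral of `g` is continuous with zero weak derivative, hence
constant. -/
theorem HasWeakDeriv.isPrimitive {u g : ℝ → ℝ} (hu : HasWeakDeriv univ u g) (hc : Continuous u) :
    IsPrimitive u g := by
  have hg : LocallyIntegrable g volume := locallyIntegrableOn_univ.1 hu.locallyIntegrableOn_deriv
  have hW := IsPrimitive.integral hg 0
  have key := eq_of_integral_mul_deriv_eq_zero (hc.sub hW.continuous) (by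
    intro φ hφ hφc
    have e1 := hu.integral_eq φ hφ hφc (subset_univ _)
    have e2 := hW.hasWeakDeriv_univ.integral_eq φ hφ hφc (subset_univ _)
    have i1 : Integrable (fun x => u x * deriv φ x) :=
      (hc.mul (hφ.continuous_deriv (by simp))).integrable_of_hasCompactSupport hφc.deriv.mul_left
    simp only [Pi.sub_apply, sub_mul]
    rw [integral_sub i1 (hW.integrable_mul_deriv hφ hφc), e1, e2, sub_self])
  refine ⟨hg, fun x y => ?_⟩
  have := key x y
  simp only [Pi.sub_apply] at this
  rw [hW.integral_eq]
  linarith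

/-! ### The linear equation `p' = l p - W` -/

/-- The solution `x ↦ ∫_{t > x} e^{-l (t - x)} W t dt` of `p' = l p - W` that stays bounded at `+∞`,
with its bounds. -/
noncomputable def backwardSolution (l : ℝ) (W : ℝ → ℝ) (x : ℝ) : ℝ :=
  Real.exp (l * x) * ∫ t in Ioi x, Real.exp (-l * t) * W t

section BackwardSolution

variable {l : ℝ} {W W' : ℝ → ℝ} {m M : ℝ}

theorem integrableOn_exp_mul (hl : 0 < l) (hW : AEStronglyMeasurable W volume)
    (hb : ∀ᵐ x, m ≤ W x ∧ W x ≤ M) (x : ℝ) :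
    IntegrableOn (fun t => Real.exp (-l * t) * W t) (Ioi x) := by
  refine (integrableOn_exp_mul_Ioi (neg_lt_zero.2 hl) x).mul_bdd (c := max |m| |M|) hW.restrict ?_
  filter_upwards [ae_restrict_of_ae hb] with t ht
  exact abs_le_max_abs_abs ht.1 ht.2

/-- This is the case of constant `W`. Since the solution is monotone in `W`, it converts bounds on
`W` into bounds on the solution. -/
theorem exp_mul_integral_exp (hl : 0 < l) (m x : ℝ) :
    Real.exp (l * x) * ∫ t in Ioi x, Real.exp (-l * t) * m = m / l := by
  rw [integral_mul_const, integral_exp_mul_Ioi (neg_lt_zero.2 hl)]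
  have : Real.exp (l * x) * Real.exp (-(l * x)) = 1 := by
    rw [← Real.exp_add]; simp
  simp only [neg_mul]
  field_simp
  linear_combination m * this

theorem le_backwardSolution (hl : 0 < l) (hW : AEStronglyMeasurable W volume)
    (hb : ∀ᵐ x, m ≤ W x ∧ W x ≤ M) (x : ℝ) : m / l ≤ backwardSolution l W x := by
  rw [← exp_mul_integral_exp hl m x, backwardSolution]
  refine mul_le_mul_of_nonneg_left ?_ (Real.exp_pos _).le
  refine integral_mono_ae ((integrableOn_exp_mul_Ioi (neg_lt_zero.2 hl) x).mul_const _)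
    (integrableOn_exp_mul hl hW hb x) ?_
  filter_upwards [ae_restrict_of_ae hb] with t ht
  exact mul_le_mul_of_nonneg_left ht.1 (Real.exp_pos _).le

theorem backwardSolution_le (hl : 0 < l) (hW : AEStronglyMeasurable W volume)
    (hb : ∀ᵐ x, m ≤ W x ∧ W x ≤ M) (x : ℝ) : backwardSolution l W x ≤ M / l := by
  rw [← exp_mul_integral_exp hl M x, backwardSolution]
  refine mul_le_mul_of_nonneg_left ?_ (Real.exp_pos _).le
  refine integral_mono_ae (integrableOn_exp_mul hl hW hb x)
    ((integrableOn_exp_mul_Ioi (neg_lt_zero.2 hl) x).mul_const _) ?_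
  filter_upwards [ae_restrict_of_ae hb] with t ht
  exact mul_le_mul_of_nonneg_left ht.2 (Real.exp_pos _).le

theorem isPrimitive_backwardSolution (hl : 0 < l) (hW : AEStronglyMeasurable W volume)
    (hb : ∀ᵐ x, m ≤ W x ∧ W x ≤ M) :
    IsPrimitive (backwardSolution l W) (fun x => l * backwardSolution l W x - W x) := by
  have hi := integrableOn_exp_mul hl hW hb
  have hloc : LocallyIntegrable (fun t => - (Real.exp (-l * t) * W t)) volume := fun x =>
    ⟨Ioi (x - 1), Ioi_mem_nhds (by linarith), (hi _).neg⟩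
  have hG : IsPrimitive (fun x => ∫ t in Ioi x, Real.exp (-l * t) * W t)
      (fun t => - (Real.exp (-l * t) * W t)) := by
    refine ⟨hloc, fun x y => ?_⟩
    rw [intervalIntegral.integral_neg, ← intervalIntegral.integral_Ioi_sub_Ioi' (hi x) (hi y)]
    ring
  have hE : IsPrimitive (fun x => Real.exp (l * x)) (fun x => Real.exp (l * x) * l) :=
    IsPrimitive.of_hasDerivAt (fun x => by
      simpa using ((hasDerivAt_id x).const_mul l).exp) (by fun_prop)
  refine (hE.mul hG).congr_ae (Filter.Eventually.of_forall fun x => ?_)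
  have : Real.exp (l * x) * Real.exp (-(l * x)) = 1 := by
    rw [← Real.exp_add]; simp
  simp only [backwardSolution, neg_mul]
  linear_combination - W x * this

/-- The solution is linear in `W`, so the preceding bounds apply to `W - W'` with the constants `-K`
and `K`. -/
theorem abs_backwardSolution_sub_le (hl : 0 < l) (hW : AEStronglyMeasurable W volume)
    (hb : ∀ᵐ x, m ≤ W x ∧ W x ≤ M) (hW' : AEStronglyMeasurable W' volume)
    (hb' : ∀ᵐ x, m ≤ W' x ∧ W' x ≤ M) {K : ℝ} (hK : ∀ x, |W x - W' x| ≤ K) (x : ℝ) :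
    |backwardSolution l W x - backwardSolution l W' x| ≤ K / l := by
  have e : backwardSolution l W x - backwardSolution l W' x
      = backwardSolution l (fun t => W t - W' t) x := by
    simp only [backwardSolution, mul_sub]
    rw [integral_sub (integrableOn_exp_mul hl hW hb x) (integrableOn_exp_mul hl hW' hb' x), mul_sub]
  have hK' : ∀ᵐ x, -K ≤ W x - W' x ∧ W x - W' x ≤ K :=
    Filter.Eventually.of_forall fun x => abs_le.1 (hK x)
  rw [e, abs_le, ← neg_div]
  exact ⟨le_backwardSolution hl (hW.sub hW') hK' x, backwardSolution_le hl (hW.sub hW') hK' x⟩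

end BackwardSolution

/-! ### The Riccati equation -/

/-- The function `c ↦ 2βc - c²` increases up to `c = β`, so its extremes on `[α, β]` are at the
endpoints. Adding `V ∈ [α², β²]` gives values in `[2βα, 2β²]`, and division by `l = 2β` returns to
`[α, β]`. -/
theorem riccati_nonlinearity_bounds {α β c : ℝ} (h : α ≤ c ∧ c ≤ β) :
    2 * β * α - α ^ 2 ≤ 2 * β * c - c ^ 2 ∧ 2 * β * c - c ^ 2 ≤ β ^ 2 := by
  constructor
  · nlinarith [mul_nonneg (sub_nonneg.2 h.1) (sub_nonneg.2 h.2), sub_nonneg.2 h.1]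
  · nlinarith [sq_nonneg (β - c)]

/-- The Riccati equation `p' = p² - V` has a solution on the whole line that takes its values
between the square roots of the bounds of `V`. -/
theorem exists_isPrimitive_riccati {V : ℝ → ℝ} {α β : ℝ} (hα : 0 < α)
    (hV : AEStronglyMeasurable V volume) (hb : ∀ᵐ x, α ^ 2 ≤ V x ∧ V x ≤ β ^ 2) (hαβ : α ≤ β) :
    ∃ p : ℝ → ℝ, (∀ x, α ≤ p x ∧ p x ≤ β) ∧ IsPrimitive p (fun x => p x ^ 2 - V x) := by
  have hβ : 0 < β := hα.trans_le hαβ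
  -- The equation is rewritten as `p' = 2β p - (V + 2β p - p²)`; the shift `2β` makes the nonlinear
  -- term monotone on `[α, β]`.
  have hl : 0 < 2 * β := by positivity
  -- Truncation to `[α, β]` defines the iteration on all bounded continuous functions, a complete
  -- space. The fixed point already lies in `[α, β]` and does not feel it.
  let clamp : ℝ → ℝ := fun y => max α (min y β)
  have hclamp : ∀ y, α ≤ clamp y ∧ clamp y ≤ β := fun y =>
    ⟨le_max_left _ _, max_le hαβ (min_le_right _ _)⟩
  have hclamp_lip : ∀ y z, |clamp y - clamp z| ≤ |y - z| := fun y z => by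
    refine (abs_max_sub_max_le_max _ _ _ _).trans ?_
    refine max_le (by simp) ((abs_min_sub_min_le_max _ _ _ _).trans ?_)
    simp
  have hclamp_cont : Continuous clamp := by fun_prop
  let W : (ℝ →ᵇ ℝ) → ℝ → ℝ := fun p x => V x + (2 * β * clamp (p x) - clamp (p x) ^ 2)
  have hWm : ∀ p, AEStronglyMeasurable (W p) volume := fun p => by
    refine hV.add (Continuous.aestronglyMeasurable ?_)
    have := hclamp_cont.comp p.continuous
    simp only [Function.comp_def] at this
    fun_prop
  have hWb : ∀ p, ∀ᵐ x, 2 * β * α ≤ W p x ∧ W p x ≤ 2 * β * β := fun p => by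
    filter_upwards [hb] with x hx
    have := riccati_nonlinearity_bounds (hclamp (p x))
    simp only [W]
    constructor <;> nlinarith
  have hSb : ∀ p x, α ≤ backwardSolution (2 * β) (W p) x ∧
      backwardSolution (2 * β) (W p) x ≤ β := fun p x => by
    have h1 := le_backwardSolution hl (hWm p) (hWb p) x
    have h2 := backwardSolution_le hl (hWm p) (hWb p) x
    rw [mul_div_cancel_left₀ _ hl.ne'] at h1 h2
    exact ⟨h1, h2⟩
  let T : (ℝ →ᵇ ℝ) → (ℝ →ᵇ ℝ) := fun p =>
    BoundedContinuousFunction.ofNormedAddCommGroup (backwardSolution (2 * β) (W p))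
      (isPrimitive_backwardSolution hl (hWm p) (hWb p)).continuous β (fun x => by
        rw [Real.norm_eq_abs, abs_of_nonneg (hα.le.trans (hSb p x).1)]
        exact (hSb p x).2)
  have hK0 : 0 ≤ 1 - α / β := by
    rw [sub_nonneg, div_le_one hβ]
    exact hαβ
  -- On `[α, β]` the nonlinearity has Lipschitz constant `2β - 2α`; solving the linear equation
  -- divides by `2β`, which leaves `1 - α / β < 1`.
  have hT : ContractingWith (1 - α / β).toNNReal T := by
    refine ⟨?_, LipschitzWith.of_dist_le_mul fun p q => ?_⟩
    · rw [Real.toNNReal_lt_one]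
      linarith [div_pos hα hβ]
    · rw [Real.coe_toNNReal _ hK0, BoundedContinuousFunction.dist_le (mul_nonneg hK0 dist_nonneg)]
      intro x
      have key : ∀ x, |W p x - W q x| ≤ (2 * β - 2 * α) * dist p q := fun x => by
        have e : W p x - W q x
            = (clamp (p x) - clamp (q x)) * (2 * β - clamp (p x) - clamp (q x)) := by
          simp only [W]; ring
        have h1 := hclamp (p x)
        have h2 := hclamp (q x)
        have h3 : |clamp (p x) - clamp (q x)| ≤ dist p q :=
          (hclamp_lip _ _).trans
            (BoundedContinuousFunction.dist_coe_le_dist (f := p) (g := q) x)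
        rw [e, abs_mul, abs_of_nonneg (by linarith : 0 ≤ 2 * β - clamp (p x) - clamp (q x)),
          mul_comm]
        exact mul_le_mul (by linarith) h3 (abs_nonneg _) (by linarith)
      refine (abs_backwardSolution_sub_le hl (hWm p) (hWb p) (hWm q) (hWb q) key x).trans_eq ?_
      field_simp
  let p := ContractingWith.fixedPoint T hT
  have hp : ∀ x, backwardSolution (2 * β) (W p) x = p x := fun x =>
    congrArg (fun q : ℝ →ᵇ ℝ => q x) hT.fixedPoint_isFixedPt
  have hpb : ∀ x, α ≤ p x ∧ p x ≤ β := fun x => hp x ▸ hSb p x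
  refine ⟨p, hpb, ?_⟩
  have h1 := isPrimitive_backwardSolution hl (hWm p) (hWb p)
  rw [show backwardSolution (2 * β) (W p) = p from funext hp] at h1
  refine h1.congr_ae (Filter.Eventually.of_forall fun x => ?_)
  have h2 : clamp (p x) = p x := by
    simp only [clamp]
    rw [min_eq_left (hpb x).2, max_eq_right (hpb x).1]
  simp only [W, h2]
  ring

/-! ### Completing the square -/

section Calibration

variable {V w g p r : ℝ → ℝ} {C β a : ℝ}

theorem MeasureTheory.MemLp.integrable_mul_self {f : ℝ → ℝ} (hf : MemLp f 2 volume) :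
    Integrable (fun x => f x * f x) := by
  exact hf.integrable_mul hf

theorem integrable_energy (hV : AEStronglyMeasurable V volume) (hVb : ∀ᵐ x, |V x| ≤ C)
    (hw : MemLp w 2 volume) (hg : MemLp g 2 volume) :
    Integrable (fun x => g x ^ 2 + V x * w x ^ 2) := by
  simp only [sq]
  exact hg.integrable_mul_self.add (hw.integrable_mul_self.bdd_mul hV hVb)

/-- The derivative of `p w²` is integrable when `p` is a bounded solution of the Riccati equation
and `w` is in `H¹`. -/
theorem integrable_calibration (hV : AEStronglyMeasurable V volume) (hVb : ∀ᵐ x, |V x| ≤ C)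
    (hp : AEStronglyMeasurable p volume) (hpb : ∀ x, |p x| ≤ β)
    (hw : MemLp w 2 volume) (hg : MemLp g 2 volume) :
    Integrable (fun x => (p x ^ 2 - V x) * (w x * w x) + p x * (g x * w x + w x * g x)) := by
  have h1 : Integrable (fun x => g x * w x + w x * g x) := (hg.integrable_mul hw).add
    (hw.integrable_mul hg)
  refine (hw.integrable_mul_self.bdd_mul (c := β ^ 2 + C) ((hp.pow 2).sub hV) ?_).add
    (h1.bdd_mul hp (Filter.Eventually.of_forall hpb))
  filter_upwards [hVb] with x hx
  refine (norm_sub_le _ _).trans (add_le_add ?_ hx)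
  rw [Pi.pow_apply, norm_pow]
  exact pow_le_pow_left₀ (norm_nonneg _) (hpb x) 2

theorem tendsto_calibration (hV : AEStronglyMeasurable V volume) (hVb : ∀ᵐ x, |V x| ≤ C)
    (hp : IsPrimitive p (fun x => p x ^ 2 - V x)) (hpb : ∀ x, |p x| ≤ β)
    (hwg : IsPrimitive w g) (hw : MemLp w 2 volume) (hg : MemLp g 2 volume) :
    Filter.Tendsto (fun x => p x * (w x * w x)) Filter.atTop (nhds 0) := by
  have hpm := hp.continuous.aestronglyMeasurable (μ := volume)
  exact (hp.mul (hwg.mul hwg)).tendsto_zero 0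
    (integrable_calibration hV hVb hpm hpb hw hg).integrableOn
    (hw.integrable_mul_self.bdd_mul hpm (Filter.Eventually.of_forall hpb)).integrableOn

/-- The defect that remains after completing the square is integrable. -/
theorem integrable_defect (hV : AEStronglyMeasurable V volume) (hVb : ∀ᵐ x, |V x| ≤ C)
    (hp : AEStronglyMeasurable p volume) (hpb : ∀ x, |p x| ≤ β)
    (hw : MemLp w 2 volume) (hg : MemLp g 2 volume) :
    Integrable (fun x => (g x + p x * w x) ^ 2) := by
  refine ((integrable_energy hV hVb hw hg).add (integrable_calibration hV hVb hp hpb hw hg)).congr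
    (Filter.Eventually.of_forall fun x => ?_)
  simp only [Pi.add_apply]
  ring

/-- By the Riccati equation the cross term and the `p² w²` term of the square combine with `-V w²`
into `(p w²)'`. Its integral is `-p(a) w(a)²`, since `p w²` tends to `0` at infinity. -/
theorem integral_Ioi_energy (hV : AEStronglyMeasurable V volume) (hVb : ∀ᵐ x, |V x| ≤ C)
    (hp : IsPrimitive p (fun x => p x ^ 2 - V x)) (hpb : ∀ x, |p x| ≤ β)
    (hwg : IsPrimitive w g) (hw : MemLp w 2 volume) (hg : MemLp g 2 volume) (a : ℝ) :
    ∫ x in Ioi a, (g x ^ 2 + V x * w x ^ 2)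
      = (∫ x in Ioi a, (g x + p x * w x) ^ 2) + p a * w a ^ 2 := by
  have hE := integrable_energy hV hVb hw hg
  have hF := integrable_calibration hV hVb
    (hp.continuous.aestronglyMeasurable (μ := volume)) hpb hw hg
  have e : ∀ x, (g x + p x * w x) ^ 2 = (g x ^ 2 + V x * w x ^ 2)
      + ((p x ^ 2 - V x) * (w x * w x) + p x * (g x * w x + w x * g x)) := fun x => by ring
  have h := (hp.mul (hwg.mul hwg)).integral_Ioi a hF.integrableOn
    (tendsto_calibration hV hVb hp hpb hwg hw hg)
  simp only [e]
  rw [integral_add hE.integrableOn hF.integrableOn, h]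
  ring

/-- Reflection reduces this to the right half-line: `x ↦ -r(-x)` solves the Riccati equation with
potential `V(-x)`. -/
theorem integral_Iic_energy (hV : AEStronglyMeasurable V volume) (hVb : ∀ᵐ x, |V x| ≤ C)
    (hr : IsPrimitive r (fun x => r x ^ 2 - V x)) (hrb : ∀ x, |r x| ≤ β)
    (hwg : IsPrimitive w g) (hw : MemLp w 2 volume) (hg : MemLp g 2 volume) (a : ℝ) :
    ∫ x in Iic a, (g x ^ 2 + V x * w x ^ 2)
      = (∫ x in Iic a, (g x + r x * w x) ^ 2) - r a * w a ^ 2 := by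
  have mp := Measure.measurePreserving_neg (volume : Measure ℝ)
  have hr' : IsPrimitive (fun x => - r (-x)) (fun x => (- r (-x)) ^ 2 - V (-x)) :=
    hr.comp_neg.neg.congr_ae (Filter.Eventually.of_forall fun x => by simp)
  have h := integral_Ioi_energy (hV.comp_measurePreserving mp)
    (mp.quasiMeasurePreserving.ae hVb) hr' (fun x => by simpa using hrb (-x)) hwg.comp_neg
    (hw.comp_measurePreserving mp) (hg.comp_measurePreserving mp).neg (-a)
  have e : ∀ x, (- g (-x) + - r (-x) * w (-x)) ^ 2 = (g (-x) + r (-x) * w (-x)) ^ 2 :=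
    fun x => by ring
  simp only [Function.comp_apply, e, neg_sq, neg_neg] at h
  rw [integral_comp_neg_Ioi (f := fun x => g x ^ 2 + V x * w x ^ 2),
    integral_comp_neg_Ioi (f := fun x => (g x + r x * w x) ^ 2), neg_neg] at h
  rw [h]
  ring

open Classical in
/-- Completing the square: the energy of `w` is that of the jump of the Riccati solution at `a`
plus a nonnegative defect. -/
theorem integral_energy (hV : AEStronglyMeasurable V volume) (hVb : ∀ᵐ x, |V x| ≤ C)
    (hp : IsPrimitive p (fun x => p x ^ 2 - V x)) (hpb : ∀ x, |p x| ≤ β)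
    (hr : IsPrimitive r (fun x => r x ^ 2 - V x)) (hrb : ∀ x, |r x| ≤ β)
    (hwg : IsPrimitive w g) (hw : MemLp w 2 volume) (hg : MemLp g 2 volume) (a : ℝ) :
    Integrable (fun x => (g x + (Ioi a).piecewise p r x * w x) ^ 2) ∧
    ∫ x, (g x ^ 2 + V x * w x ^ 2)
      = (∫ x, (g x + (Ioi a).piecewise p r x * w x) ^ 2) + (p a - r a) * w a ^ 2 := by
  have e1 := integral_Ioi_energy hV hVb hp hpb hwg hw hg a
  have e2 := integral_Iic_energy hV hVb hr hrb hwg hw hg a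
  have c1 : EqOn (fun x => (g x + p x * w x) ^ 2)
      (fun x => (g x + (Ioi a).piecewise p r x * w x) ^ 2) (Ioi a) := fun x hx => by
    simp only
    rw [piecewise_eq_of_mem _ _ _ hx]
  have c2 : EqOn (fun x => (g x + r x * w x) ^ 2)
      (fun x => (g x + (Ioi a).piecewise p r x * w x) ^ 2) (Iic a) := fun x hx => by
    simp only
    rw [piecewise_eq_of_notMem _ _ _ (by simpa using hx)]
  have i1 := (integrableOn_congr_fun c1 measurableSet_Ioi).1 (integrable_defect hV hVb
    hp.continuous.aestronglyMeasurable hpb hw hg).integrableOn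
  have i2 := (integrableOn_congr_fun c2 measurableSet_Iic).1 (integrable_defect hV hVb
    hr.continuous.aestronglyMeasurable hrb hw hg).integrableOn
  rw [setIntegral_congr_fun measurableSet_Ioi c1] at e1
  rw [setIntegral_congr_fun measurableSet_Iic c2] at e2
  have hE := integrable_energy hV hVb hw hg
  constructor
  · rw [← integrableOn_univ, ← Iic_union_Ioi (a := a)]
    exact i2.union i1
  · rw [← intervalIntegral.integral_Iic_add_Ioi (b := a) hE.integrableOn hE.integrableOn,
      ← intervalIntegral.integral_Iic_add_Ioi (b := a) i2 i1, e1, e2]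
    ring

end Calibration

/-! ### The first-order equation for the minimizer -/

/-- The solution of `u' = - p u` with `u a = 1`. -/
noncomputable def expSolution (a : ℝ) (p : ℝ → ℝ) (x : ℝ) : ℝ :=
  Real.exp (- ∫ t in a..x, p t)

section ExpSolution

variable {a α β : ℝ} {p V w : ℝ → ℝ}

theorem expSolution_self : expSolution a p a = 1 := by simp [expSolution]

theorem hasDerivAt_expSolution (hp : Continuous p) (x : ℝ) :
    HasDerivAt (expSolution a p) (- p x * expSolution a p x) x := by
  have := ((hp.integral_hasStrictDerivAt a x).hasDerivAt.neg).exp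
  rw [mul_comm]
  exact this

theorem continuous_expSolution (hp : Continuous p) : Continuous (expSolution a p) :=
  continuous_iff_continuousAt.2 fun x => (hasDerivAt_expSolution hp x).continuousAt

theorem contDiff_expSolution (hp : Continuous p) : ContDiff ℝ 1 (expSolution a p) := by
  rw [contDiff_one_iff_deriv]
  refine ⟨fun x => (hasDerivAt_expSolution hp x).differentiableAt, ?_⟩
  rw [show deriv (expSolution a p) = fun x => - p x * expSolution a p x from
    funext fun x => (hasDerivAt_expSolution hp x).deriv]
  exact hp.neg.mul (continuous_expSolution hp)

theorem isPrimitive_expSolution (hp : Continuous p) :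
    IsPrimitive (expSolution a p) (fun x => - p x * expSolution a p x) :=
  IsPrimitive.of_hasDerivAt (hasDerivAt_expSolution hp) (hp.neg.mul (continuous_expSolution hp))

/-- If `p` solves the Riccati equation, then `u = expSolution a p` solves `u'' = V u`. -/
theorem isPrimitive_deriv_expSolution (hp : IsPrimitive p (fun x => p x ^ 2 - V x)) :
    IsPrimitive (fun x => - p x * expSolution a p x) (fun x => V x * expSolution a p x) :=
  (hp.neg.mul (isPrimitive_expSolution hp.continuous)).congr_ae
    (Filter.Eventually.of_forall fun x => by ring)

theorem expSolution_bounds_right (hp : Continuous p) (hb : ∀ x, α ≤ p x ∧ p x ≤ β) {x : ℝ}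
    (hx : a ≤ x) : Real.exp (-(β * (x - a))) ≤ expSolution a p x ∧
      expSolution a p x ≤ Real.exp (-(α * (x - a))) := by
  have h1 := intervalIntegral.integral_mono_on hx intervalIntegrable_const
    (hp.intervalIntegrable (μ := volume) a x) (fun t _ => (hb t).1)
  have h2 := intervalIntegral.integral_mono_on hx (hp.intervalIntegrable (μ := volume) a x)
    intervalIntegrable_const (fun t _ => (hb t).2)
  simp only [intervalIntegral.integral_const, smul_eq_mul] at h1 h2
  constructor <;> refine Real.exp_le_exp.2 ?_ <;> linarith

theorem expSolution_bounds_left (hp : Continuous p) (hb : ∀ x, α ≤ - p x ∧ - p x ≤ β) {x : ℝ}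
    (hx : x ≤ a) : Real.exp (-(β * (a - x))) ≤ expSolution a p x ∧
      expSolution a p x ≤ Real.exp (-(α * (a - x))) := by
  have h1 := intervalIntegral.integral_mono_on hx intervalIntegrable_const
    (hp.neg.intervalIntegrable (μ := volume) x a) (fun t _ => (hb t).1)
  have h2 := intervalIntegral.integral_mono_on hx (hp.neg.intervalIntegrable (μ := volume) x a)
    intervalIntegrable_const (fun t _ => (hb t).2)
  simp only [intervalIntegral.integral_const, smul_eq_mul, Pi.neg_apply,
    intervalIntegral.integral_neg] at h1 h2
  have h3 := intervalIntegral.integral_symm (μ := volume) (f := p) a x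
  constructor <;> refine Real.exp_le_exp.2 ?_ <;> linarith

/-- Solutions of `w' = - p w` on an interval starting at `a` are multiples of `expSolution a p`. -/
theorem eq_expSolution {g : ℝ → ℝ} (hp : Continuous p) (hw : IsPrimitive w g) {x : ℝ}
    (h : ∀ᵐ t, t ∈ uIoo a x → g t = - p t * w t) : w x = w a * expSolution a p x := by
  -- The factor `expSolution a (-p)` is the reciprocal of `expSolution a p`; its product with `w`
  -- has zero derivative on the interval.
  have hm := hw.mul (isPrimitive_expSolution (a := a) hp.neg)
  have e := hm.integral_eq a x
  rw [intervalIntegral.integral_congr_ae_restrict (g := fun _ => 0)] at e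
  · have e2 : expSolution a p x * expSolution a (-p) x = 1 := by
      rw [expSolution, expSolution, ← Real.exp_add]
      simp
    simp only [intervalIntegral.integral_zero, expSolution_self] at e
    linear_combination (- w x) * e2 - expSolution a p x * e
  · rw [Filter.EventuallyEq, ae_restrict_iff' measurableSet_uIoc]
    -- The integral runs over a half-open interval while `h` concerns the open one; the extra
    -- endpoint is a null set.
    have hx : ∀ᵐ t : ℝ, t ≠ max a x := by simp [ae_iff]
    filter_upwards [h, hx] with t ht htx htm
    have : t ∈ uIoo a x := ⟨htm.1, lt_of_le_of_ne htm.2 htx⟩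
    rw [ht this]
    simp only [Pi.neg_apply]
    ring

end ExpSolution

/-! ### The candidate minimizer -/

open Classical in
/-- The function with value `1` at `a` and logarithmic derivative `-p` to the right of `a`
and `-r` to the left of `a`. -/
noncomputable def peak (a : ℝ) (p r : ℝ → ℝ) : ℝ → ℝ :=
  (Ioi a).piecewise (expSolution a p) (expSolution a r)

section Peak

variable {a α β C : ℝ} {p r V w : ℝ → ℝ}

theorem peak_of_le {x : ℝ} (hx : a ≤ x) : peak a p r x = expSolution a p x := by
  rcases hx.eq_or_lt with rfl | hx
  · rw [peak, piecewise_eq_of_notMem _ _ _ (by simp), expSolution_self, expSolution_self]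
  · rw [peak, piecewise_eq_of_mem _ _ _ (mem_Ioi.2 hx)]

theorem peak_of_ge {x : ℝ} (hx : x ≤ a) : peak a p r x = expSolution a r x := by
  rw [peak, piecewise_eq_of_notMem _ _ _ (by simpa using hx)]

theorem peak_self : peak a p r a = 1 := by rw [peak_of_le le_rfl, expSolution_self]

theorem peak_eventuallyEq_right {x : ℝ} (hx : a < x) :
    peak a p r =ᶠ[nhds x] expSolution a p := by
  filter_upwards [Ioi_mem_nhds hx] with y hy using peak_of_le (le_of_lt hy)

theorem peak_eventuallyEq_left {x : ℝ} (hx : x < a) :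
    peak a p r =ᶠ[nhds x] expSolution a r := by
  filter_upwards [Iio_mem_nhds hx] with y hy using peak_of_ge (le_of_lt hy)

theorem deriv_peak_right (hp : Continuous p) {x : ℝ} (hx : a < x) :
    deriv (peak a p r) x = - p x * peak a p r x := by
  rw [(peak_eventuallyEq_right hx).deriv_eq, (hasDerivAt_expSolution hp x).deriv,
    peak_of_le hx.le]

theorem deriv_peak_left (hr : Continuous r) {x : ℝ} (hx : x < a) :
    deriv (peak a p r) x = - r x * peak a p r x := by
  rw [(peak_eventuallyEq_left hx).deriv_eq, (hasDerivAt_expSolution hr x).deriv,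
    peak_of_ge hx.le]

theorem contDiffOn_peak (hp : Continuous p) (hr : Continuous r) :
    ContDiffOn ℝ 1 (peak a p r) {a}ᶜ := by
  intro x hx
  refine ContDiffAt.contDiffWithinAt ?_
  rcases lt_or_gt_of_ne hx with h | h
  · exact (contDiff_expSolution hr).contDiffAt.congr_of_eventuallyEq (peak_eventuallyEq_left h)
  · exact (contDiff_expSolution hp).contDiffAt.congr_of_eventuallyEq (peak_eventuallyEq_right h)

theorem peak_bounds (hp : Continuous p) (hr : Continuous r) (hpb : ∀ x, α ≤ p x ∧ p x ≤ β)
    (hrb : ∀ x, α ≤ - r x ∧ - r x ≤ β) (x : ℝ) :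
    Real.exp (-(β * |x - a|)) ≤ peak a p r x ∧ peak a p r x ≤ Real.exp (-(α * |x - a|)) := by
  rcases le_total a x with h | h
  · rw [peak_of_le h, abs_of_nonneg (sub_nonneg.2 h)]
    exact expSolution_bounds_right hp hpb h
  · rw [peak_of_ge h, abs_of_nonpos (sub_nonpos.2 h), neg_sub]
    exact expSolution_bounds_left hr hrb h

open Classical in
theorem isPrimitive_peak (hp : Continuous p) (hr : Continuous r) :
    IsPrimitive (peak a p r) (fun x => - (Ioi a).piecewise p r x * peak a p r x) := by
  refine ((isPrimitive_expSolution hp).piecewise (isPrimitive_expSolution hr)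
    (by rw [expSolution_self, expSolution_self])).congr_ae (Filter.Eventually.of_forall fun x => ?_)
  by_cases hx : x ∈ Ioi a
  · simp only [piecewise_eq_of_mem _ _ _ hx, peak]
  · simp only [piecewise_eq_of_notMem _ _ _ hx, peak]

-- The one-sided slopes at `a` are `-p(a)` and `-r(a)`, so the second derivative is taken only off
-- `a`.
open Classical in
theorem hasWeakDeriv_deriv_peak (hp : IsPrimitive p (fun x => p x ^ 2 - V x))
    (hr : IsPrimitive r (fun x => r x ^ 2 - V x)) :
    HasWeakDeriv {a}ᶜ (fun x => - (Ioi a).piecewise p r x * peak a p r x)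
      (fun x => V x * peak a p r x) := by
  refine ((isPrimitive_deriv_expSolution (a := a) hp).hasWeakDeriv_compl_singleton
    (isPrimitive_deriv_expSolution (a := a) hr) a).congr_ae
    (Filter.Eventually.of_forall fun x => ?_) (Filter.Eventually.of_forall fun x => ?_) <;>
  by_cases hx : x ∈ Ioi a <;>
  simp [piecewise, peak, hx]

theorem integrable_exp_neg_mul_abs_sub (hα : 0 < α) (a : ℝ) :
    Integrable (fun x : ℝ => Real.exp (-(α * |x - a|))) := by
  have h : Integrable (fun x : ℝ => Real.exp (-(α * |x|))) := by
    rw [← integrableOn_univ, ← Iic_union_Ioi (a := (0 : ℝ))]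
    refine IntegrableOn.union ?_ ?_
    · refine (integrableOn_exp_mul_Iic hα 0).congr_fun (fun x hx => ?_) measurableSet_Iic
      simp only [abs_of_nonpos (mem_Iic.1 hx)]
      congr 1
      ring
    · refine (integrableOn_exp_mul_Ioi (neg_lt_zero.2 hα) 0).congr_fun (fun x hx => ?_)
        measurableSet_Ioi
      simp only [abs_of_pos (mem_Ioi.1 hx), neg_mul]
  exact h.comp_sub_right a

theorem memLp_peak (hα : 0 < α) (hp : Continuous p) (hr : Continuous r)
    (hpb : ∀ x, α ≤ p x ∧ p x ≤ β) (hrb : ∀ x, α ≤ - r x ∧ - r x ≤ β) :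
    MemLp (peak a p r) 2 volume := by
  have hm := (isPrimitive_peak (a := a) hp hr).continuous.aestronglyMeasurable (μ := volume)
  rw [memLp_two_iff_integrable_sq hm]
  refine (integrable_exp_neg_mul_abs_sub (α := 2 * α) (by positivity) a).mono' (hm.pow 2)
    (Filter.Eventually.of_forall fun x => ?_)
  have h := peak_bounds (a := a) hp hr hpb hrb x
  have h0 : 0 ≤ peak a p r x := (Real.exp_pos _).le.trans h.1
  rw [Real.norm_eq_abs, abs_of_nonneg (sq_nonneg _)]
  refine (pow_le_pow_left₀ h0 h.2 2).trans_eq ?_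
  rw [← Real.exp_nat_mul]
  congr 1
  push_cast
  ring

open Classical in
theorem abs_piecewise_le (hpb : ∀ x, |p x| ≤ β) (hrb : ∀ x, |r x| ≤ β) (x : ℝ) :
    |(Ioi a).piecewise p r x| ≤ β := by
  by_cases hx : x ∈ Ioi a
  · rw [piecewise_eq_of_mem _ _ _ hx]
    exact hpb x
  · rw [piecewise_eq_of_notMem _ _ _ hx]
    exact hrb x

theorem eLpNorm_top_eq_one {u : ℝ → ℝ} (hu : Continuous u) (hb : ∀ x, |u x| ≤ 1) (ha : u a = 1) :
    eLpNorm u ∞ volume = 1 := by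
  rw [eLpNorm_exponent_top]
  refine le_antisymm ?_ ?_
  · simpa using eLpNormEssSup_le_of_ae_bound (μ := volume) (f := u) (C := 1)
      (Filter.Eventually.of_forall hb)
  -- If the essential supremum were below `1`, the set where `|u|` exceeds it would be open and
  -- contain `a`, hence have positive measure.
  · by_contra! hlt
    have ho : IsOpen {x | eLpNormEssSup u volume < ‖u x‖ₑ} :=
      isOpen_lt continuous_const hu.enorm
    have hpos := ho.measure_pos volume ⟨a, by simpa [ha] using hlt⟩
    have h0 : volume {x | eLpNormEssSup u volume < ‖u x‖ₑ} = 0 := by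
      simpa [ae_iff] using enorm_ae_le_eLpNormEssSup u volume
    exact hpos.ne' h0

/-- `weakDeriv` is an arbitrary choice of representative; uniqueness almost everywhere transfers
square integrability to it. -/
theorem isPrimitive_weakDeriv_of_mem_H1 (hw : w ∈ H1) :
    IsPrimitive w (weakDeriv univ w) ∧ MemLp w 2 volume ∧ MemLp (weakDeriv univ w) 2 volume := by
  obtain ⟨hc, h2, g, hg, hg2⟩ := hw
  simp only [MemSobolev, Measure.restrict_univ] at h2 hg2
  have hd := hg.weakDeriv
  refine ⟨hd.isPrimitive hc, h2, hg2.ae_eq ?_⟩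
  filter_upwards [hg.ae_unique isOpen_univ hd] with x hx using hx (mem_univ x)

/-! ### Minimality, uniqueness and regularity of the peak -/

/-- The bounded solutions of the Riccati equation with a favourable sign at infinity. -/
structure RiccatiPair (V : ℝ → ℝ) (α β : ℝ) (p r : ℝ → ℝ) : Prop where
  right : IsPrimitive p (fun x => p x ^ 2 - V x)
  left : IsPrimitive r (fun x => r x ^ 2 - V x)
  right_bounds : ∀ x, α ≤ p x ∧ p x ≤ β
  left_bounds : ∀ x, α ≤ - r x ∧ - r x ≤ β

namespace RiccatiPair

theorem abs_right_le (h : RiccatiPair V α β p r) (hα : 0 < α) (x : ℝ) : |p x| ≤ β :=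
  abs_le.2 ⟨by linarith [h.right_bounds x], (h.right_bounds x).2⟩

theorem abs_left_le (h : RiccatiPair V α β p r) (hα : 0 < α) (x : ℝ) : |r x| ≤ β :=
  abs_le.2 ⟨by linarith [h.left_bounds x], by linarith [h.left_bounds x]⟩

theorem abs_peak_le_one (h : RiccatiPair V α β p r) (hα : 0 < α) (x : ℝ) :
    |peak a p r x| ≤ 1 := by
  have hb := peak_bounds (a := a) h.right.continuous h.left.continuous h.right_bounds
    h.left_bounds x
  rw [abs_of_nonneg ((Real.exp_pos _).le.trans hb.1)]
  refine hb.2.trans (Real.exp_le_one_iff.2 ?_)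
  have := abs_nonneg (x - a)
  nlinarith

open Classical in
theorem peak_mem_KSet (h : RiccatiPair V α β p r) (hα : 0 < α) : peak a p r ∈ KSet a := by
  have hprim := isPrimitive_peak (a := a) h.right.continuous h.left.continuous
  have h2 := memLp_peak (a := a) hα h.right.continuous h.left.continuous h.right_bounds
    h.left_bounds
  refine ⟨⟨hprim.continuous, ?_⟩, peak_self,
    eLpNorm_top_eq_one hprim.continuous (h.abs_peak_le_one hα) peak_self⟩
  simp only [MemSobolev, Measure.restrict_univ]
  refine ⟨h2, _, hprim.hasWeakDeriv_univ, ?_⟩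
  refine MemLp.of_le_mul (c := β) h2 hprim.locallyIntegrable.aestronglyMeasurable
    (Filter.Eventually.of_forall fun x => ?_)
  rw [norm_mul, norm_neg]
  exact mul_le_mul_of_nonneg_right (abs_piecewise_le (h.abs_right_le hα) (h.abs_left_le hα) x)
    (norm_nonneg _)

open Classical in
theorem normVSq_eq (h : RiccatiPair V α β p r) (hα : 0 < α) (hV : AEStronglyMeasurable V volume)
    (hVb : ∀ᵐ x, |V x| ≤ C) (hw : w ∈ KSet a) :
    Integrable (fun x => (weakDeriv univ w x + (Ioi a).piecewise p r x * w x) ^ 2) ∧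
    normVSq V w = (∫ x, (weakDeriv univ w x + (Ioi a).piecewise p r x * w x) ^ 2)
      + (p a - r a) := by
  obtain ⟨hwg, hw2, hg2⟩ := isPrimitive_weakDeriv_of_mem_H1 hw.1
  obtain ⟨h1, h2⟩ := integral_energy hV hVb h.right (h.abs_right_le hα) h.left
    (h.abs_left_le hα) hwg hw2 hg2 a
  refine ⟨h1, ?_⟩
  rw [hw.2.1] at h2
  simpa [normVSq] using h2

theorem le_normVSq (h : RiccatiPair V α β p r) (hα : 0 < α) (hV : AEStronglyMeasurable V volume)
    (hVb : ∀ᵐ x, |V x| ≤ C) (hw : w ∈ KSet a) : p a - r a ≤ normVSq V w := by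
  rw [(h.normVSq_eq hα hV hVb hw).2]
  exact le_add_of_nonneg_left (integral_nonneg fun x => sq_nonneg _)

theorem normVSq_peak (h : RiccatiPair V α β p r) (hα : 0 < α)
    (hV : AEStronglyMeasurable V volume) (hVb : ∀ᵐ x, |V x| ≤ C) :
    normVSq V (peak a p r) = p a - r a := by
  classical
  rw [(h.normVSq_eq hα hV hVb (h.peak_mem_KSet hα)).2]
  have hprim := isPrimitive_peak (a := a) h.right.continuous h.left.continuous
  rw [integral_eq_zero_of_ae, zero_add]
  filter_upwards [hprim.hasWeakDeriv_univ.ae_unique isOpen_univ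
    hprim.hasWeakDeriv_univ.weakDeriv] with x hx
  rw [← hx (mem_univ x)]
  simp

/-- Minimal energy forces the integral of the squared defect to vanish, so `w` solves the
first-order equation almost everywhere on each side of `a`, with `w(a) = 1`. -/
theorem eq_peak (h : RiccatiPair V α β p r) (hα : 0 < α)
    (hV : AEStronglyMeasurable V volume) (hVb : ∀ᵐ x, |V x| ≤ C) (hw : w ∈ KSet a)
    (hle : normVSq V w ≤ p a - r a) : w = peak a p r := by
  classical
  obtain ⟨hi, he⟩ := h.normVSq_eq hα hV hVb hw
  have h0 : ∫ x, (weakDeriv univ w x + (Ioi a).piecewise p r x * w x) ^ 2 = 0 :=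
    le_antisymm (by linarith) (integral_nonneg fun x => sq_nonneg _)
  rw [integral_eq_zero_iff_of_nonneg (fun x => sq_nonneg _) hi] at h0
  have hwg := (isPrimitive_weakDeriv_of_mem_H1 hw.1).1
  ext x
  rcases le_total a x with hx | hx
  · rw [peak_of_le hx, eq_expSolution h.right.continuous hwg (a := a), hw.2.1, one_mul]
    filter_upwards [h0] with t ht hta
    rw [uIoo_of_le hx] at hta
    have := pow_eq_zero_iff (two_ne_zero) |>.1 ht
    rw [piecewise_eq_of_mem _ _ _ (mem_Ioi.2 hta.1)] at this
    linarith
  · rw [peak_of_ge hx, eq_expSolution h.left.continuous hwg (a := a), hw.2.1, one_mul]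
    filter_upwards [h0] with t ht hta
    rw [uIoo_of_ge hx] at hta
    have := pow_eq_zero_iff (two_ne_zero) |>.1 ht
    rw [piecewise_eq_of_notMem _ _ _ (by simpa using hta.2.le)] at this
    linarith

open Classical in
theorem memSobolev_top_peak (h : RiccatiPair V α β p r) (hα : 0 < α)
    (hV : AEStronglyMeasurable V volume) (hVb : ∀ᵐ x, |V x| ≤ C) :
    MemSobolev ∞ {a}ᶜ 2 (peak a p r) := by
  have hprim := isPrimitive_peak (a := a) h.right.continuous h.left.continuous
  have hc := hprim.continuous.aestronglyMeasurable (μ := volume)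
  have h1 := h.abs_peak_le_one (a := a) hα
  refine ⟨(memLp_top_of_bound hc 1 (Filter.Eventually.of_forall h1)).restrict _, _,
    hprim.hasWeakDeriv_univ.mono (subset_univ _), ?_, _,
    hasWeakDeriv_deriv_peak h.right h.left, ?_⟩
  · refine (memLp_top_of_bound hprim.locallyIntegrable.aestronglyMeasurable (β * 1)
      (Filter.Eventually.of_forall fun x => ?_)).restrict _
    rw [norm_mul, norm_neg]
    have := abs_piecewise_le (a := a) (h.abs_right_le hα) (h.abs_left_le hα) x
    exact mul_le_mul this (h1 x) (norm_nonneg _) ((abs_nonneg _).trans this)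
  · refine (memLp_top_of_bound (hV.mul hc) (C * 1) ?_).restrict _
    filter_upwards [hVb] with x hx
    rw [Pi.mul_apply, norm_mul]
    exact mul_le_mul hx (h1 x) (norm_nonneg _) ((abs_nonneg _).trans hx)

theorem weakDeriv_weakDeriv_peak (h : RiccatiPair V α β p r) :
    ∀ᵐ x ∂(volume : Measure ℝ), x ∈ ({a}ᶜ : Set ℝ) →
      weakDeriv {a}ᶜ (weakDeriv {a}ᶜ (peak a p r)) x = V x * peak a p r x := by
  classical
  have ho : IsOpen ({a}ᶜ : Set ℝ) := isOpen_compl_singleton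
  have h1 := (isPrimitive_peak (a := a) h.right.continuous
    h.left.continuous).hasWeakDeriv_univ.mono (subset_univ {a}ᶜ)
  have h2 := hasWeakDeriv_deriv_peak (a := a) h.right h.left
  have ha : ∀ᵐ x : ℝ, x ∈ ({a}ᶜ : Set ℝ) := by simp [ae_iff]
  have h3 : HasWeakDeriv {a}ᶜ (weakDeriv {a}ᶜ (peak a p r)) (fun x => V x * peak a p r x) := by
    refine h2.congr_ae ?_ Filter.EventuallyEq.rfl
    filter_upwards [h1.ae_unique ho h1.weakDeriv, ha] with x hx hxa using hx hxa
  exact h3.weakDeriv.ae_unique ho h3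

theorem sign_mul_deriv_peak (h : RiccatiPair V α β p r) (hα : 0 < α) {x : ℝ} (hx : x ≠ a) :
    α * Real.exp (-(β * |x - a|)) ≤ Real.sign (a - x) * deriv (peak a p r) x ∧
      Real.sign (a - x) * deriv (peak a p r) x ≤ β * Real.exp (-(α * |x - a|)) := by
  have hb := peak_bounds (a := a) h.right.continuous h.left.continuous h.right_bounds
    h.left_bounds x
  have h0 := (Real.exp_pos (-(β * |x - a|))).le
  rcases lt_or_gt_of_ne hx with hlt | hgt
  · have hr := h.left_bounds x
    rw [Real.sign_of_pos (sub_pos.2 hlt), deriv_peak_left h.left.continuous hlt, one_mul]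
    exact ⟨mul_le_mul hr.1 hb.1 h0 (by linarith),
      mul_le_mul hr.2 hb.2 (h0.trans hb.1) (by linarith)⟩
  · have hp := h.right_bounds x
    rw [Real.sign_of_neg (sub_neg.2 hgt), deriv_peak_right h.right.continuous hgt, neg_mul, one_mul,
      neg_mul, neg_neg]
    exact ⟨mul_le_mul hp.1 hb.1 h0 (by linarith),
      mul_le_mul hp.2 hb.2 (h0.trans hb.1) (by linarith)⟩

end RiccatiPair

/-- The left solution is `r(x) = -q(-x)`, where `q` is the right solution for the reflected
potential. -/
theorem exists_riccatiPair (hα : 0 < α) (hαβ : α ≤ β) (hV : AEStronglyMeasurable V volume)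
    (hb : ∀ᵐ x, α ^ 2 ≤ V x ∧ V x ≤ β ^ 2) : ∃ p r, RiccatiPair V α β p r := by
  have mp := Measure.measurePreserving_neg (volume : Measure ℝ)
  obtain ⟨p, hpb, hp⟩ := exists_isPrimitive_riccati hα hV hb hαβ
  obtain ⟨q, hqb, hq⟩ := exists_isPrimitive_riccati (V := fun x => V (-x)) hα
    (hV.comp_measurePreserving mp) (mp.quasiMeasurePreserving.ae hb) hαβ
  refine ⟨p, fun x => - q (-x), hp, ?_, hpb, fun x => by simpa using hqb (-x)⟩
  exact hq.comp_neg.neg.congr_ae (Filter.Eventually.of_forall fun x => by simp)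

theorem riccatiPair_const {c : ℝ} (hc : 0 < c) (hV : ∀ᵐ x, V x = c) :
    RiccatiPair V √c √c (fun _ => √c) (fun _ => -√c) := by
  have h0 : (fun _ : ℝ => (0 : ℝ)) =ᵐ[volume] fun x => c - V x := by
    filter_upwards [hV] with x hx
    rw [hx, sub_self]
  have hs := Real.sq_sqrt hc.le
  refine ⟨?_, ?_, fun x => ⟨le_rfl, le_rfl⟩, fun x => by simp⟩
  · simp only [hs]
    exact (IsPrimitive.of_hasDerivAt (fun x => hasDerivAt_const x _) continuous_const).congr_ae h0
  · simp only [neg_sq, hs]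
    exact (IsPrimitive.of_hasDerivAt (fun x => hasDerivAt_const x _) continuous_const).congr_ae h0

end Peak

/-! ### The main theorem -/

theorem mainTheorem2 (V : ℝ → ℝ) (v₀ v₁ : ℝ) (hV : MemLp V ∞ volume) (hv₀ : 0 < v₀)
    (hbd : ∀ᵐ x ∂(volume : Measure ℝ), v₀ ≤ V x ∧ V x ≤ v₁) (a : ℝ) :
    ∃ u : ℝ → ℝ,
      -- `u` is the unique minimizer of `‖·‖_V²` over `K_a`
      (u ∈ KSet a ∧ (∀ w ∈ KSet a, normVSq V u ≤ normVSq V w) ∧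
        (∀ w ∈ KSet a, (∀ z ∈ KSet a, normVSq V w ≤ normVSq V z) → w = u) ∧
        FInf V a = normVSq V u) ∧
      -- `u ∈ W^{2,∞}(ℝ ∖ {a})` and `u'' = V u` a.e. in `ℝ ∖ {a}`
      (MemSobolev ∞ {a}ᶜ 2 u ∧
        ∀ᵐ x ∂(volume : Measure ℝ), x ∈ ({a}ᶜ : Set ℝ) →
          weakDeriv {a}ᶜ (weakDeriv {a}ᶜ u) x = V x * u x) ∧
      -- two-sided bounds for `u`
      (∀ x : ℝ, Real.exp (-(√v₁ * |x - a|)) ≤ u x ∧ u x ≤ Real.exp (-(√v₀ * |x - a|))) ∧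
      -- `u` is `C¹` off `a`, with two-sided bounds for the classical derivative
      (ContDiffOn ℝ 1 u {a}ᶜ ∧
        ∀ x : ℝ, x ≠ a →
          v₀ / √v₁ * Real.exp (-(√v₁ * |x - a|)) ≤ Real.sign (a - x) * deriv u x ∧
          Real.sign (a - x) * deriv u x ≤ v₁ / √v₀ * Real.exp (-(√v₀ * |x - a|))) ∧
      -- the case of a constant potential
      (∀ c : ℝ, 0 < c → (∀ᵐ x ∂(volume : Measure ℝ), V x = c) →
        ∀ x : ℝ, u x = Real.exp (-(√c * |x - a|))) := by
  have hV' := hV.aestronglyMeasurable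
  obtain ⟨x₀, hx₀⟩ := hbd.exists
  have h01 : v₀ ≤ v₁ := hx₀.1.trans hx₀.2
  have hv₁ : 0 < v₁ := hv₀.trans_le h01
  have hs0 : 0 < √v₀ := Real.sqrt_pos.2 hv₀
  have hs1 : 0 < √v₁ := Real.sqrt_pos.2 hv₁
  have hs01 : √v₀ ≤ √v₁ := Real.sqrt_le_sqrt h01
  have hsq0 := Real.sq_sqrt hv₀.le
  have hsq1 := Real.sq_sqrt hv₁.le
  have hVb : ∀ᵐ x, |V x| ≤ v₁ := by
    filter_upwards [hbd] with x hx
    rw [abs_of_nonneg (hv₀.le.trans hx.1)]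
    exact hx.2
  obtain ⟨p, r, h⟩ := exists_riccatiPair hs0 hs01 hV' (by rwa [hsq0, hsq1])
  have hmem : peak a p r ∈ KSet a := h.peak_mem_KSet hs0
  have hval : normVSq V (peak a p r) = p a - r a := h.normVSq_peak hs0 hV' hVb
  have hmin : ∀ w ∈ KSet a, normVSq V (peak a p r) ≤ normVSq V w := fun w hw =>
    hval ▸ h.le_normVSq hs0 hV' hVb hw
  refine ⟨peak a p r, ⟨hmem, hmin, fun w hw hwmin => ?_, ?_⟩,
    ⟨h.memSobolev_top_peak hs0 hV' hVb, h.weakDeriv_weakDeriv_peak⟩,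
    peak_bounds h.right.continuous h.left.continuous h.right_bounds h.left_bounds,
    ⟨contDiffOn_peak h.right.continuous h.left.continuous, fun x hx => ?_⟩, fun c hc hVc x => ?_⟩
  · exact h.eq_peak hs0 hV' hVb hw (hval ▸ hwmin _ hmem)
  · refine IsLeast.csInf_eq ⟨mem_image_of_mem _ hmem, ?_⟩
    rintro _ ⟨w, hw, rfl⟩
    exact hmin w hw
  · obtain ⟨h1, h2⟩ := h.sign_mul_deriv_peak hs0 hx
    refine ⟨le_trans (mul_le_mul_of_nonneg_right ?_ (Real.exp_pos _).le) h1,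
      h2.trans (mul_le_mul_of_nonneg_right ?_ (Real.exp_pos _).le)⟩
    -- The bounds just obtained have the sharper constants `√v₀` and `√v₁`; the stated ones follow
    -- from `√v₀ ≤ √v₁`.
    · rw [div_le_iff₀ hs1]
      nlinarith
    · rw [le_div_iff₀ hs0]
      nlinarith
  · have hsc : 0 < √c := Real.sqrt_pos.2 hc
    -- The constants `±√c` form another Riccati pair for the same `V`. By uniqueness its peak is the
    -- same minimizer, and its upper and lower exponential bounds coincide.
    have h' := riccatiPair_const hc hVc
    rw [h'.eq_peak hsc hV' hVb hmem
      ((hmin _ (h'.peak_mem_KSet hsc)).trans_eq (h'.normVSq_peak hsc hV' hVb))]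
    have hb := peak_bounds (a := a) h'.right.continuous h'.left.continuous h'.right_bounds
      h'.left_bounds x
    exact le_antisymm hb.2 hb.1
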